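/- Let $(S,\hat h)$ be a two-dimensional oriented smooth Riemannian manifold with volume form $\hat\eta$, let $I\subset\mathbb{R}$, and let $u,f:I\to\mathbb{R}$ be smooth. Let $Z:S\to I$ be a smooth function and $\hat w$ a smooth one-form on $S$ such that $$\mathrm{Hess}\,Z=(u\circ Z)\,\hat h,\qquad d\hat w=(f\circ Z)\,\hat\eta ,$$ where $\mathrm{Hess}\,Z=\nabla dZ$ for the Levi-Civita connection $\nabla$ of $\hat h$. Let $U$ be any connected component of the open set $\{p\in S:\ dZ|_p\neq 0\}$. Then there exist functions $V$ and $F$ on $Z(U)$ with $$V'=2u,\qquad F'=f \qquad\text{on } Z(U),$$ such that every point of $U$ has an open neighbourhood $W\subset U$ carrying a smooth coordinate system $(Z,x)$, whose first coordinate is the function $Z$ itself, in which $$\hat h=\frac{dZ^2}{V(Z)}+V(Z)\,dx^2,\qquad \hat w=F(Z)\,dx+\hat w_0$$ for some smooth closed one-form $\hat w_0$ on $W$. Moreover, for the same coordinates, $\star dZ=-V(Z)\,dx$ on $W$, where the Hodge dual of a one-form $\alpha$ is $(\star\alpha)_A=\hat\eta_{AB}\,\alpha^B$, i.e. $(\star\alpha)(v)=\hat\eta(v,\alpha^\sharp)$.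 -/

import Mathlib

open scoped Manifold ContDiff Bundle

noncomputable section

namespace Surface

/-- The coordinate plane `ℝ²`. -/
abbrev Plane : Type := EuclideanSpace ℝ (Fin 2)

section Charts

variable {S : Type*} [TopologicalSpace S] [ChartedSpace Plane S]

/-- The `i`-th coordinate vector field `∂ᵢ` of the chart `e`, at the point with coordinates `y`. -/
def coordVec (e : OpenPartialHomeomorph S Plane) (i : Fin 2) (y : Plane) :
    TangentSpace (𝓡 2) (e.symm y) :=
  mfderiv (𝓡 2) (𝓡 2) e.symm y (EuclideanSpace.single i (1 : ℝ) : Plane)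

/-- The partial derivative `∂ᵢ φ` of a function on the coordinate plane. -/
def pderiv (i : Fin 2) (φ : Plane → ℝ) (y : Plane) : ℝ :=
  fderiv ℝ φ y (EuclideanSpace.single i (1 : ℝ))

/-- One-forms on `S` (no regularity yet). -/
abbrev OneForm (S : Type*) [TopologicalSpace S] [ChartedSpace Plane S] : Type _ :=
  (p : S) → (TangentSpace (𝓡 2) p →L[ℝ] ℝ)

/-- The differential `dφ` of a scalar function. -/
def differential (φ : S → ℝ) : OneForm S :=
  fun p => mvfderiv (𝓡 2) φ p

/-- The one-form `α` is smooth on the set `s`, as a section of the cotangent bundle. -/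
def SmoothFormOn [IsManifold (𝓡 2) ∞ S] (α : OneForm S) (s : Set S) : Prop :=
  ContMDiffOn (𝓡 2) ((𝓡 2).prod 𝓘(ℝ, Plane →L[ℝ] ℝ)) ∞
    (fun p => Bundle.TotalSpace.mk' (Plane →L[ℝ] ℝ)
      (E := fun p : S => TangentSpace (𝓡 2) p →L[ℝ] Bundle.Trivial S ℝ p) p (α p)) s

/-- The component `αᵢ = α(∂ᵢ)` of a one-form in the chart `e`, as a function of coordinates. -/
def formComp (α : OneForm S) (e : OpenPartialHomeomorph S Plane) (i : Fin 2) (y : Plane) : ℝ :=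
  α (e.symm y) (coordVec e i y)

/-- The component `(dα)ᵢⱼ = ∂ᵢ αⱼ - ∂ⱼ αᵢ` of the exterior derivative in the chart `e`. -/
def extDerivComp (α : OneForm S) (e : OpenPartialHomeomorph S Plane) (i j : Fin 2) (y : Plane) :
    ℝ :=
  pderiv i (formComp α e j) y - pderiv j (formComp α e i) y

/-- The one-form `α` is closed at every point of `s`: the components of `dα` vanish there in
every smooth chart. -/
def ClosedFormOn [IsManifold (𝓡 2) ∞ S] (α : OneForm S) (s : Set S) : Prop :=
  ∀ e ∈ IsManifold.maximalAtlas (𝓡 2) ∞ S, ∀ y ∈ e.target, e.symm y ∈ s →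
    ∀ i j : Fin 2, extDerivComp α e i j y = 0

variable (S) in
/-- An orientation of the surface `S`: an orientation of every tangent plane which varies
continuously, that is, every point lies in a smooth chart whose coordinate frame is positively
oriented at all points of its domain. -/
structure SurfaceOrientation [IsManifold (𝓡 2) ∞ S] where
  /-- The orientation of each tangent plane. -/
  at_point : (p : S) → Orientation ℝ (TangentSpace (𝓡 2) p) (Fin 2)
  continuous' : ∀ p : S, ∃ e ∈ IsManifold.maximalAtlas (𝓡 2) ∞ S, p ∈ e.source ∧
    ∀ y ∈ e.target, ∃ b : Module.Basis (Fin 2) ℝ (TangentSpace (𝓡 2) (e.symm y)),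
      (∀ i, b i = coordVec e i y) ∧ b.orientation = at_point (e.symm y)

end Charts

section Metric

variable {S : Type*} [TopologicalSpace S] [ChartedSpace Plane S]
  [Bundle.RiemannianBundle (fun p : S => TangentSpace (𝓡 2) p)]

/-- The metric coefficients `hᵢⱼ = h(∂ᵢ, ∂ⱼ)` in the chart `e`. -/
def metricComp (e : OpenPartialHomeomorph S Plane) (y : Plane) : Matrix (Fin 2) (Fin 2) ℝ :=
  Matrix.of fun i j => inner ℝ (coordVec e i y) (coordVec e j y)

/-- The Christoffel symbols
`Γᵏᵢⱼ = ½ ∑ₗ hᵏˡ (∂ᵢ hⱼₗ + ∂ⱼ hᵢₗ - ∂ₗ hᵢⱼ)` of the Levi-Civita connection. -/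
def christoffel (e : OpenPartialHomeomorph S Plane) (k i j : Fin 2) (y : Plane) : ℝ :=
  (1 / 2 : ℝ) * ∑ l : Fin 2, (metricComp e y)⁻¹ k l *
    (pderiv i (fun z => metricComp e z j l) y + pderiv j (fun z => metricComp e z i l) y
      - pderiv l (fun z => metricComp e z i j) y)

/-- The component `(Hess φ)ᵢⱼ = ∂ᵢ ∂ⱼ φ - ∑ₖ Γᵏᵢⱼ ∂ₖ φ` of the covariant Hessian `∇dφ`
in the chart `e`. -/
def hessComp (φ : S → ℝ) (e : OpenPartialHomeomorph S Plane) (i j : Fin 2) (y : Plane) : ℝ :=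
  pderiv i (pderiv j (φ ∘ e.symm)) y - ∑ k : Fin 2, christoffel e k i j y *
    pderiv k (φ ∘ e.symm) y

/-- The equation `Hess φ = c h` of symmetric two-tensors, with `c` a scalar function: equality of
all components in every smooth chart. -/
def HessianEq [IsManifold (𝓡 2) ∞ S] (φ c : S → ℝ) : Prop :=
  ∀ e ∈ IsManifold.maximalAtlas (𝓡 2) ∞ S, ∀ y ∈ e.target, ∀ i j : Fin 2,
    hessComp φ e i j y = c (e.symm y) * metricComp e y i j

instance finrank_tangent (p : S) : Fact (Module.finrank ℝ (TangentSpace (𝓡 2) p) = 2) :=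
  ⟨finrank_euclideanSpace_fin (𝕜 := ℝ) (n := 2)⟩

instance finiteDimensional_tangent (p : S) : FiniteDimensional ℝ (TangentSpace (𝓡 2) p) :=
  inferInstanceAs (FiniteDimensional ℝ Plane)

variable [IsManifold (𝓡 2) ∞ S]

/-- The Riemannian volume two-form `η`: `η(v, w) = 1` if `(v, w)` is a positively oriented
orthonormal basis. -/
def volForm (o : SurfaceOrientation S) (p : S) (v w : TangentSpace (𝓡 2) p) : ℝ :=
  (o.at_point p).areaForm v w

/-- The equation `dα = c η` of two-forms, with `c` a scalar function: equality of all components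
in every smooth chart. -/
def ExtDerivEq (o : SurfaceOrientation S) (α : OneForm S) (c : S → ℝ) : Prop :=
  ∀ e ∈ IsManifold.maximalAtlas (𝓡 2) ∞ S, ∀ y ∈ e.target, ∀ i j : Fin 2,
    extDerivComp α e i j y =
      c (e.symm y) * volForm o (e.symm y) (coordVec e i y) (coordVec e j y)

/-- The vector `α♯` metrically dual to a covector, `h(α♯, v) = α(v)`. -/
def sharp (p : S) (α : TangentSpace (𝓡 2) p →L[ℝ] ℝ) : TangentSpace (𝓡 2) p :=
  haveI : CompleteSpace (TangentSpace (𝓡 2) p) := FiniteDimensional.complete ℝ _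
  (InnerProductSpace.toDual ℝ (TangentSpace (𝓡 2) p)).symm α

/-- The Hodge dual of a one-form, with the convention `(⋆α)_A = η_{AB} α^B`, that is
`(⋆α)(v) = η(v, α♯)`. -/
def hodgeStar (o : SurfaceOrientation S) (α : OneForm S) (p : S) (v : TangentSpace (𝓡 2) p) : ℝ :=
  volForm o p v (sharp p (α p))

end Metric

end Surface

end

/-!
Write `N = |dZ|²` and `ξ = -⋆dZ / N` on the set where `dZ ≠ 0`. In a chart, contracting
`Hess Z = u(Z) h` with `∇Z` gives `dN = 2 u(Z) dZ` (`IsOrientedChart.pderiv_gradSq`), and its trace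
gives `div ∇Z = 2 u(Z)`. Hence `N` and a primitive of `2 u` composed with `Z` differ by a constant
on the connected set `U` (`exists_gradSq_eq_add`); that primitive, shifted by the constant, is `V`,
so that `N = V(Z)`. The primitives exist because `Z(U)` is an open interval.

The same two identities say that `ξ` is closed, since
`d(⋆dZ / N) = (div ∇Z / N - ⟨∇Z, ∇N⟩ / N²) η = 0` up to sign
(`IsOrientedChart.hodgeStar_div_gradSq_closed`). By the Poincaré lemma `ξ = dx` on a coordinate
ball, and the Jacobian of `(Z, x)` is the area density, so the inverse function theorem makes
`(Z, x)` a chart (`IsOrientedChart.exists_adapted_chart`).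

As `⋆` is a rotation, `N h = dZ² + (⋆dZ)²` and `N η = -dZ ∧ ⋆dZ`; with `⋆dZ = -V(Z) dx` these are
the normal form of the metric and `η = dZ ∧ dx`. The latter gives `d(F(Z) dx) = f(Z) η` for `F' = f`,
so `w - F(Z) dx` is closed (`closedFormOn_sub_smul`).
-/

noncomputable section

namespace Surface

open Filter Topology Set

/-! ### Partial derivatives on the coordinate plane -/

lemma pderiv_add {i : Fin 2} {φ ψ : Plane → ℝ} {y : Plane} (hφ : DifferentiableAt ℝ φ y)
    (hψ : DifferentiableAt ℝ ψ y) :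
    pderiv i (fun t => φ t + ψ t) y = pderiv i φ y + pderiv i ψ y := by
  simp [pderiv, fderiv_fun_add hφ hψ]

lemma pderiv_sub {i : Fin 2} {φ ψ : Plane → ℝ} {y : Plane} (hφ : DifferentiableAt ℝ φ y)
    (hψ : DifferentiableAt ℝ ψ y) :
    pderiv i (fun t => φ t - ψ t) y = pderiv i φ y - pderiv i ψ y := by
  simp [pderiv, fderiv_fun_sub hφ hψ]

lemma pderiv_neg {i : Fin 2} {φ : Plane → ℝ} {y : Plane} :
    pderiv i (fun t => -φ t) y = -pderiv i φ y := by
  simp [pderiv, fderiv_fun_neg]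

lemma pderiv_mul {i : Fin 2} {φ ψ : Plane → ℝ} {y : Plane} (hφ : DifferentiableAt ℝ φ y)
    (hψ : DifferentiableAt ℝ ψ y) :
    pderiv i (fun t => φ t * ψ t) y = pderiv i φ y * ψ y + φ y * pderiv i ψ y := by
  simp [pderiv, fderiv_fun_mul hφ hψ]; ring

lemma pderiv_congr {i : Fin 2} {φ ψ : Plane → ℝ} {y : Plane} (h : φ =ᶠ[𝓝 y] ψ) :
    pderiv i φ y = pderiv i ψ y := by
  rw [pderiv, pderiv, h.fderiv_eq]

lemma pderiv_comp {i : Fin 2} {g : ℝ → ℝ} {g' : ℝ} {φ : Plane → ℝ} {y : Plane}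
    (hg : HasDerivAt g g' (φ y)) (hφ : DifferentiableAt ℝ φ y) :
    pderiv i (fun t => g (φ t)) y = g' * pderiv i φ y := by
  have := (hg.comp_hasFDerivAt y hφ.hasFDerivAt).fderiv
  simp only [Function.comp_def] at this
  simp [pderiv, this]

lemma fderiv_apply_eq_pderiv (φ : Plane → ℝ) (y v : Plane) :
    fderiv ℝ φ y v = v 0 * pderiv 0 φ y + v 1 * pderiv 1 φ y := by
  have hv : v = v 0 • EuclideanSpace.single 0 (1 : ℝ) + v 1 • EuclideanSpace.single 1 (1 : ℝ) := by
    ext i; fin_cases i <;> simp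
  conv_lhs => rw [hv]
  simp [pderiv]

lemma fderiv_eq_zero_of_pderiv {φ : Plane → ℝ} {y : Plane} (h : ∀ i, pderiv i φ y = 0) :
    fderiv ℝ φ y = 0 := by
  ext v; simp [fderiv_apply_eq_pderiv, h]

lemma pderiv_pderiv_comm {φ : Plane → ℝ} {y : Plane} (hφ : ContDiffAt ℝ ∞ φ y) (i j : Fin 2) :
    pderiv i (pderiv j φ) y = pderiv j (pderiv i φ) y := by
  have hd : DifferentiableAt ℝ (fderiv ℝ φ) y :=
    (hφ.fderiv_right (m := 1) (by norm_cast)).differentiableAt one_ne_zero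
  have key : ∀ k l : Fin 2, pderiv k (pderiv l φ) y =
      fderiv ℝ (fderiv ℝ φ) y (EuclideanSpace.single k 1) (EuclideanSpace.single l 1) := by
    intro k l
    have h : pderiv l φ = fun t => fderiv ℝ φ t (EuclideanSpace.single l 1) := rfl
    rw [pderiv, h, fderiv_clm_apply hd (by fun_prop)]
    simp
  rw [key, key]
  exact (hφ.isSymmSndFDerivAt (by simp; norm_cast)).eq _ _

lemma _root_.ContDiffAt.pderiv {φ : Plane → ℝ} {y : Plane} (hφ : ContDiffAt ℝ ∞ φ y) (i : Fin 2) :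
    ContDiffAt ℝ ∞ (pderiv i φ) y :=
  (hφ.fderiv_right (m := ∞) (by norm_cast)).clm_apply contDiffAt_const

/-! ### The equation `Hess z = c h` for functions of two variables -/

/-- In coordinates, `∂ₖ |∇z|² = 2 c ∂ₖ z` when `Hess z = c h`. The metric is `E dx² + 2 F dx dy + G
dy²`, `z₀, z₁` are the partial derivatives of `z`, the functions `a, b` are the components of `∇z`,
and `|∇z|² = a z₀ + b z₁`. Only the contraction `hess` of the Hessian equation with `∇z` is needed;
there the Christoffel terms combine to `½ aⁱ aʲ ∂ₖ hᵢⱼ`. -/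
lemma pderiv_normSq_grad {E F G z₀ z₁ a b : Plane → ℝ} {y : Plane} {c : ℝ} {k : Fin 2}
    (hE : DifferentiableAt ℝ E y) (hF : DifferentiableAt ℝ F y) (hG : DifferentiableAt ℝ G y)
    (hz₀ : DifferentiableAt ℝ z₀ y) (hz₁ : DifferentiableAt ℝ z₁ y)
    (ha : DifferentiableAt ℝ a y) (hb : DifferentiableAt ℝ b y)
    (h₀ : ∀ᶠ t in 𝓝 y, z₀ t = E t * a t + F t * b t)
    (h₁ : ∀ᶠ t in 𝓝 y, z₁ t = F t * a t + G t * b t)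
    (hess : a y * pderiv k z₀ y + b y * pderiv k z₁ y =
      (a y ^ 2 * pderiv k E y + 2 * (a y * b y) * pderiv k F y + b y ^ 2 * pderiv k G y) / 2
        + c * (if k = 0 then z₀ y else z₁ y)) :
    pderiv k (fun t => a t * z₀ t + b t * z₁ t) y = 2 * c * (if k = 0 then z₀ y else z₁ y) := by
  have e₀ := pderiv_congr (i := k) h₀
  have e₁ := pderiv_congr (i := k) h₁
  rw [pderiv_add (by fun_prop) (by fun_prop), pderiv_mul hE ha, pderiv_mul hF hb] at e₀
  rw [pderiv_add (by fun_prop) (by fun_prop), pderiv_mul hF ha, pderiv_mul hG hb] at e₁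
  rw [pderiv_add (by fun_prop) (by fun_prop), pderiv_mul ha hz₀, pderiv_mul hb hz₁]
  linear_combination 2 * hess - a y * e₀ - b y * e₁ + pderiv k a y * h₀.self_of_nhds
    + pderiv k b y * h₁.self_of_nhds

/-- The divergence `r⁻¹ (∂₀ (r a) + ∂₁ (r b))` of the gradient field `(a, b)` is the trace of the
Hessian, hence equals `2 c` when `Hess z = c h`; here `r` is the area density. The hypotheses `h00`
to `h11` are the Hessian equation, with the Christoffel symbols of the first kind written out. -/
lemma divergence_grad {E F G z₀ z₁ a b r : Plane → ℝ} {y : Plane} {c : ℝ}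
    (hE : DifferentiableAt ℝ E y) (hF : DifferentiableAt ℝ F y) (hG : DifferentiableAt ℝ G y)
    (ha : DifferentiableAt ℝ a y) (hb : DifferentiableAt ℝ b y) (hr : DifferentiableAt ℝ r y)
    (hr0 : r y ≠ 0)
    (hrD : ∀ᶠ t in 𝓝 y, r t * r t = E t * G t - F t * F t)
    (h₀ : ∀ᶠ t in 𝓝 y, z₀ t = E t * a t + F t * b t)
    (h₁ : ∀ᶠ t in 𝓝 y, z₁ t = F t * a t + G t * b t)
    (h00 : pderiv 0 z₀ y = a y * (pderiv 0 E y / 2) + b y * (pderiv 0 F y - pderiv 1 E y / 2)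
      + c * E y)
    (h01 : pderiv 0 z₁ y = a y * (pderiv 1 E y / 2) + b y * (pderiv 0 G y / 2) + c * F y)
    (h10 : pderiv 1 z₀ y = a y * (pderiv 1 E y / 2) + b y * (pderiv 0 G y / 2) + c * F y)
    (h11 : pderiv 1 z₁ y = a y * (pderiv 1 F y - pderiv 0 G y / 2) + b y * (pderiv 1 G y / 2)
      + c * G y) :
    pderiv 0 (fun t => r t * a t) y + pderiv 1 (fun t => r t * b t) y = 2 * c * r y := by
  have dz₀ : ∀ k, pderiv k z₀ y = pderiv k E y * a y + E y * pderiv k a y +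
      (pderiv k F y * b y + F y * pderiv k b y) := fun k => by
    rw [pderiv_congr h₀, pderiv_add (by fun_prop) (by fun_prop), pderiv_mul hE ha,
      pderiv_mul hF hb]
  have dz₁ : ∀ k, pderiv k z₁ y = pderiv k F y * a y + F y * pderiv k a y +
      (pderiv k G y * b y + G y * pderiv k b y) := fun k => by
    rw [pderiv_congr h₁, pderiv_add (by fun_prop) (by fun_prop), pderiv_mul hF ha,
      pderiv_mul hG hb]
  have dr : ∀ k, 2 * r y * pderiv k r y = pderiv k E y * G y + E y * pderiv k G y
      - 2 * F y * pderiv k F y := fun k => by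
    have := pderiv_congr (i := k) hrD
    rw [pderiv_mul hr hr, pderiv_sub (by fun_prop) (by fun_prop), pderiv_mul hE hG,
      pderiv_mul hF hF] at this
    linear_combination this
  have hD := hrD.self_of_nhds
  rw [pderiv_mul hr ha, pderiv_mul hr hb]
  refine mul_left_cancel₀ hr0 ?_
  linear_combination a y / 2 * dr 0 + b y / 2 * dr 1
    + (pderiv 0 a y + pderiv 1 b y - 2 * c) * hD
    - G y * dz₀ 0 + F y * dz₁ 0 - E y * dz₁ 1 + F y * dz₀ 1
    + G y * h00 - F y * h01 + E y * h11 - F y * h10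

/-- The rotated and rescaled gradient `v⁻¹ (-r b, r a)` is a closed form when `dv = 2 c dz`, where
`v` is the squared norm of the gradient `(a, b)` of `z`. -/
lemma rotated_grad_closed {z₀ z₁ a b r v : Plane → ℝ} {y : Plane} {c : ℝ}
    (ha : DifferentiableAt ℝ a y) (hb : DifferentiableAt ℝ b y) (hr : DifferentiableAt ℝ r y)
    (hv : DifferentiableAt ℝ v y) (hv0 : v y ≠ 0)
    (hv_eq : v y = a y * z₀ y + b y * z₁ y)
    (hv₀ : pderiv 0 v y = 2 * c * z₀ y) (hv₁ : pderiv 1 v y = 2 * c * z₁ y)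
    (hdiv : pderiv 0 (fun t => r t * a t) y + pderiv 1 (fun t => r t * b t) y = 2 * c * r y) :
    pderiv 0 (fun t => r t * a t * (v t)⁻¹) y = pderiv 1 (fun t => -(r t * b t) * (v t)⁻¹) y := by
  have dinv : ∀ k, pderiv k (fun t => (v t)⁻¹) y = -(v y ^ 2)⁻¹ * pderiv k v y := fun k =>
    pderiv_comp (hasDerivAt_inv hv0) hv
  have hi : DifferentiableAt ℝ (fun t => (v t)⁻¹) y := hv.inv hv0
  rw [pderiv_mul (hr.fun_mul ha) hi, pderiv_mul (hr.fun_mul hb).fun_neg hi, dinv, dinv, hv₀, hv₁,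
    pderiv_neg]
  field_simp
  linear_combination v y * hdiv + 2 * c * r y * hv_eq

/-! ### Primitives and coordinates -/

/-- A smooth one-form `p dx + q dy` on a ball of the plane with `∂₀ q = ∂₁ p` has a smooth
primitive. -/
lemma exists_smooth_primitive {p q : Plane → ℝ} {y₀ : Plane} {ε : ℝ}
    (hp : ContDiffOn ℝ ∞ p (Metric.ball y₀ ε)) (hq : ContDiffOn ℝ ∞ q (Metric.ball y₀ ε))
    (hpq : ∀ y ∈ Metric.ball y₀ ε, pderiv 0 q y = pderiv 1 p y) :
    ∃ x : Plane → ℝ, ContDiffOn ℝ ∞ x (Metric.ball y₀ ε) ∧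
      ∀ y ∈ Metric.ball y₀ ε, pderiv 0 x y = p y ∧ pderiv 1 x y = q y := by
  set B := Metric.ball y₀ ε with hB
  have hBo : IsOpen B := Metric.isOpen_ball
  let d : Fin 2 → (Plane →L[ℝ] ℝ) := fun i => EuclideanSpace.proj i
  let α : Plane → (Plane →L[ℝ] ℝ) := fun y => p y • d 0 + q y • d 1
  have hα : ContDiffOn ℝ ∞ α B := (hp.smul contDiffOn_const).add (hq.smul contDiffOn_const)
  have hsymm : ∀ y ∈ B, ∀ s t, fderiv ℝ α y s t = fderiv ℝ α y t s := by
    intro y hy s t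
    have hp' := (hp.contDiffAt (hBo.mem_nhds hy)).differentiableAt (by simp)
    have hq' := (hq.contDiffAt (hBo.mem_nhds hy)).differentiableAt (by simp)
    have : fderiv ℝ α y = (fderiv ℝ p y).smulRight (d 0) + (fderiv ℝ q y).smulRight (d 1) :=
      ((hp'.hasFDerivAt.smul_const (d 0)).add (hq'.hasFDerivAt.smul_const (d 1))).fderiv
    simp only [this, add_apply, ContinuousLinearMap.smulRight_apply,
      smul_apply, smul_eq_mul, fderiv_apply_eq_pderiv, d, PiLp.proj_apply, hpq y hy]
    ring
  obtain ⟨x, hx⟩ := (convex_ball y₀ ε).exists_forall_hasFDerivAt_of_fderiv_symmetric hBo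
    (hα.differentiableOn (by simp)) hsymm
  refine ⟨x, (contDiffOn_infty_iff_fderiv_of_isOpen hBo).2
    ⟨fun y hy => (hx y hy).differentiableAt.differentiableWithinAt,
      hα.congr fun y hy => (hx y hy).fderiv⟩, fun y hy => ?_⟩
  simp [pderiv, (hx y hy).fderiv, α, d]

/-! ### Coordinate fields and components of tensors in a smooth chart -/

section Components

variable {S : Type*} [TopologicalSpace S] [ChartedSpace Plane S]
  {e : OpenPartialHomeomorph S Plane} {y : Plane}

lemma formComp_differential (he : e ∈ IsManifold.maximalAtlas (𝓡 2) ∞ S) (hy : y ∈ e.target)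
    {φ : S → ℝ} (hφ : ContMDiffAt (𝓡 2) 𝓘(ℝ, ℝ) ∞ φ (e.symm y)) (i : Fin 2) :
    formComp (differential φ) e i y = pderiv i (φ ∘ e.symm) y := by
  have h1 : MDifferentiableAt (𝓡 2) 𝓘(ℝ, ℝ) φ (e.symm y) := hφ.mdifferentiableAt (by simp)
  have h2 : MDifferentiableAt (𝓡 2) (𝓡 2) e.symm y :=
    (contMDiffAt_symm_of_mem_maximalAtlas he hy).mdifferentiableAt (by simp)
  have := mvfderiv_comp_apply y h1 h2 (EuclideanSpace.single i (1 : ℝ) : Plane)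
  rw [formComp, differential, coordVec, ← this, pderiv, ← mfderiv_eq_fderiv]
  rfl

lemma contDiffAt_comp_symm (he : e ∈ IsManifold.maximalAtlas (𝓡 2) ∞ S) (hy : y ∈ e.target)
    {φ : S → ℝ} (hφ : ContMDiffAt (𝓡 2) 𝓘(ℝ, ℝ) ∞ φ (e.symm y)) :
    ContDiffAt ℝ ∞ (φ ∘ e.symm) y :=
  (hφ.comp y (contMDiffAt_symm_of_mem_maximalAtlas he hy)).contDiffAt

/-- The coordinate field `∂ᵢ` is smooth, being the tangent map of `e.symm` applied to a constant
field. -/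
lemma contMDiffAt_coordVec [IsManifold (𝓡 2) ∞ S]
    (he : e ∈ IsManifold.maximalAtlas (𝓡 2) ∞ S) (hy : y ∈ e.target)
    (i : Fin 2) :
    ContMDiffAt (𝓡 2) (𝓡 2).tangent ∞
      (fun t => Bundle.TotalSpace.mk' Plane (E := TangentSpace (𝓡 2) (M := S)) (e.symm t)
        (coordVec e i t)) y := by
  have h := (contMDiffOn_symm_of_mem_maximalAtlas he).contMDiffOn_tangentMapWithin
    (m := ∞) (by norm_cast) e.open_target.uniqueMDiffOn
  have h2 : ContMDiff (𝓡 2) (𝓡 2).tangent ∞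
      (fun t : Plane => (⟨t, EuclideanSpace.single i (1 : ℝ)⟩ : TangentBundle (𝓡 2) Plane)) := by
    intro t
    rw [Bundle.contMDiffAt_totalSpace]
    refine ⟨contMDiffAt_id, ?_⟩
    simp only [trivializationAt_model_space_apply]
    exact contMDiffAt_const
  have h3 := (h.comp (h2.contMDiffOn (s := e.target)) (fun t ht => ht)).contMDiffAt
    (e.open_target.mem_nhds hy)
  refine h3.congr_of_eventuallyEq ?_
  filter_upwards [e.open_target.mem_nhds hy] with t ht
  simp only [Function.comp, tangentMapWithin, coordVec]
  rw [mfderivWithin_of_isOpen e.open_target ht]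

lemma contDiffAt_formComp [IsManifold (𝓡 2) ∞ S]
    (he : e ∈ IsManifold.maximalAtlas (𝓡 2) ∞ S) (hy : y ∈ e.target)
    {α : OneForm S} {s : Set S} (hα : SmoothFormOn α s) (hs : IsOpen s) (hys : e.symm y ∈ s)
    (i : Fin 2) : ContDiffAt ℝ ∞ (formComp α e i) y := by
  have h1 := (hα.contMDiffAt (hs.mem_nhds hys)).comp y (contMDiffAt_symm_of_mem_maximalAtlas he hy)
  have h2 := ContMDiffAt.clm_bundle_apply (F₂ := ℝ) (E₂ := Bundle.Trivial S ℝ) h1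
    (contMDiffAt_coordVec he hy i)
  rw [Bundle.contMDiffAt_totalSpace] at h2
  exact h2.2.contDiffAt

lemma smoothFormOn_differential [IsManifold (𝓡 2) ∞ S] {φ : S → ℝ} {s : Set S}
    (hφ : ∀ q ∈ s, ContMDiffAt (𝓡 2) 𝓘(ℝ, ℝ) ∞ φ q) : SmoothFormOn (differential φ) s := by
  intro q hq
  refine ContMDiffAt.contMDiffWithinAt ?_
  rw [contMDiffAt_hom_bundle]
  refine ⟨contMDiffAt_id, ?_⟩
  have := (hφ q hq).mfderiv_const (m := ∞) (by norm_cast)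
  convert this using 1
  ext t v
  simp [inTangentCoordinates, ContinuousLinearMap.inCoordinates, differential, mvfderiv]
  rfl

/-- A smooth chart whose coordinate frame is positively oriented at every point. -/
def IsOrientedChart [IsManifold (𝓡 2) ∞ S] (o : SurfaceOrientation S)
    (e : OpenPartialHomeomorph S Plane) : Prop :=
  e ∈ IsManifold.maximalAtlas (𝓡 2) ∞ S ∧
    ∀ y ∈ e.target, ∃ b : Module.Basis (Fin 2) ℝ (TangentSpace (𝓡 2) (e.symm y)),
      (∀ i, b i = coordVec e i y) ∧ b.orientation = o.at_point (e.symm y)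

/-- Linear functionals on a tangent plane that agree on the coordinate frame are equal. -/
lemma IsOrientedChart.ext [IsManifold (𝓡 2) ∞ S] {o : SurfaceOrientation S}
    (he : IsOrientedChart o e) (hy : y ∈ e.target)
    {f g : TangentSpace (𝓡 2) (e.symm y) →ₗ[ℝ] ℝ}
    (h : ∀ i, f (coordVec e i y) = g (coordVec e i y)) (v) : f v = g v := by
  obtain ⟨b, hb, -⟩ := he.2 y hy
  have : f = g := b.ext fun i => by rw [hb, h]
  rw [this]

end Components

/-! ### Metric and area form in a chart -/

section Metric

variable {S : Type*} [TopologicalSpace S] [ChartedSpace Plane S]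
  [Bundle.RiemannianBundle (fun p : S => TangentSpace (𝓡 2) p)]
  {e : OpenPartialHomeomorph S Plane} {y : Plane}

lemma contDiffAt_metricComp [IsManifold (𝓡 2) ∞ S]
    [IsContMDiffRiemannianBundle (𝓡 2) ∞ Plane (fun p : S => TangentSpace (𝓡 2) p)]
    (he : e ∈ IsManifold.maximalAtlas (𝓡 2) ∞ S) (hy : y ∈ e.target) (i j : Fin 2) :
    ContDiffAt ℝ ∞ (fun t => metricComp e t i j) y :=
  ((contMDiffAt_coordVec he hy i).inner_bundle (contMDiffAt_coordVec he hy j)).contDiffAt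

lemma metricComp_comm (t : Plane) : metricComp e t 1 0 = metricComp e t 0 1 :=
  real_inner_comm (coordVec e 0 t) (coordVec e 1 t)

lemma inner_sharp (p : S) (α : TangentSpace (𝓡 2) p →L[ℝ] ℝ) (v : TangentSpace (𝓡 2) p) :
    inner ℝ (sharp p α) v = α v := by
  have : CompleteSpace (TangentSpace (𝓡 2) p) := FiniteDimensional.complete ℝ _
  exact InnerProductSpace.toDual_symm_apply

/-- The area form is positive on a positively oriented basis. -/
lemma areaForm_pos_of_basis {E : Type*} [NormedAddCommGroup E] [InnerProductSpace ℝ E]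
    [Fact (Module.finrank ℝ E = 2)] (o : Orientation ℝ E (Fin 2)) (b : Module.Basis (Fin 2) ℝ E)
    (hb : b.orientation = o) : 0 < o.areaForm (b 0) (b 1) := by
  have h2 : Module.finrank ℝ E = 2 := Fact.out
  rw [Orientation.areaForm_to_volumeForm,
    o.volumeForm_robust (o.finOrthonormalBasis (by norm_num) h2)
      (o.finOrthonormalBasis_orientation _ _)]
  have := (Module.Basis.orientation_eq_iff_det_pos
    (o.finOrthonormalBasis (by norm_num) h2).toBasis b).1 (by simp [hb])
  have hb2 : ![b 0, b 1] = b := by ext i; fin_cases i <;> rfl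
  rwa [hb2]

end Metric

/-! ### The gradient and its rotation in an oriented chart -/

section Gradient

variable {S : Type*} [TopologicalSpace S] [ChartedSpace Plane S]
  [Bundle.RiemannianBundle (fun p : S => TangentSpace (𝓡 2) p)]

/-- The squared norm `|dφ|² = dφ(∇φ)` of the gradient of `φ`. -/
def gradSq (φ : S → ℝ) (p : S) : ℝ :=
  differential φ p (sharp p (differential φ p))

/-- The determinant of the metric in the chart `e`. -/
def metricDet (e : OpenPartialHomeomorph S Plane) (y : Plane) : ℝ :=
  metricComp e y 0 0 * metricComp e y 1 1 - metricComp e y 0 1 * metricComp e y 0 1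

/-- The components in the chart `e` of the gradient of `φ`, by Cramer's rule. -/
def gradComp (φ : S → ℝ) (e : OpenPartialHomeomorph S Plane) : Fin 2 → Plane → ℝ :=
  ![fun y => (metricComp e y 1 1 * pderiv 0 (φ ∘ e.symm) y
      - metricComp e y 0 1 * pderiv 1 (φ ∘ e.symm) y) / metricDet e y,
    fun y => (metricComp e y 0 0 * pderiv 1 (φ ∘ e.symm) y
      - metricComp e y 0 1 * pderiv 0 (φ ∘ e.symm) y) / metricDet e y]

variable {e : OpenPartialHomeomorph S Plane} {y : Plane} {φ : S → ℝ}

lemma gradSq_eq_norm_sq (φ : S → ℝ) (p : S) :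
    gradSq φ p = ‖sharp p (differential φ p)‖ ^ 2 := by
  rw [gradSq, ← inner_sharp, real_inner_self_eq_norm_sq]

lemma gradSq_pos {p : S} (h : differential φ p ≠ 0) : 0 < gradSq φ p := by
  rw [gradSq_eq_norm_sq]
  have : sharp p (differential φ p) ≠ 0 := fun h0 => h <| by
    ext v
    rw [← inner_sharp, h0, inner_zero_left]; rfl
  positivity

lemma metricComp_mul_gradComp_zero (hD : metricDet e y ≠ 0) :
    pderiv 0 (φ ∘ e.symm) y = metricComp e y 0 0 * gradComp φ e 0 y
      + metricComp e y 0 1 * gradComp φ e 1 y := by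
  simp only [gradComp, Matrix.cons_val_zero, Matrix.cons_val_one]
  field_simp
  rw [metricDet]; ring

lemma metricComp_mul_gradComp_one (hD : metricDet e y ≠ 0) :
    pderiv 1 (φ ∘ e.symm) y = metricComp e y 0 1 * gradComp φ e 0 y
      + metricComp e y 1 1 * gradComp φ e 1 y := by
  simp only [gradComp, Matrix.cons_val_zero, Matrix.cons_val_one]
  field_simp
  rw [metricDet]; ring

/-- `Γᵏᵢⱼ ∂ₖφ = Γₗᵢⱼ aˡ`, where `a` is the gradient of `φ` and `Γₗᵢⱼ` are the Christoffel symbols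
of the first kind. -/
lemma hessComp_eq (i j : Fin 2) :
    hessComp φ e i j y = pderiv i (pderiv j (φ ∘ e.symm)) y - ∑ l : Fin 2, gradComp φ e l y *
      ((pderiv i (fun z => metricComp e z j l) y + pderiv j (fun z => metricComp e z i l) y
        - pderiv l (fun z => metricComp e z i j) y) / 2) := by
  simp only [hessComp, christoffel, Fin.sum_univ_two, gradComp, Matrix.inv_def,
    Matrix.adjugate_fin_two, Matrix.det_fin_two, Ring.inverse_eq_inv', Matrix.smul_apply,
    Matrix.of_apply, Matrix.cons_val_zero, Matrix.cons_val_one, Matrix.cons_val', smul_eq_mul,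
    Matrix.cons_val_fin_one, metricComp_comm, metricDet]
  ring

variable [IsManifold (𝓡 2) ∞ S] {o : SurfaceOrientation S}

lemma metricDet_eq_volForm_sq (o : SurfaceOrientation S) (y : Plane) :
    metricDet e y = volForm o (e.symm y) (coordVec e 0 y) (coordVec e 1 y) ^ 2 := by
  have := (o.at_point (e.symm y)).inner_sq_add_areaForm_sq (coordVec e 0 y) (coordVec e 1 y)
  rw [← real_inner_self_eq_norm_sq, ← real_inner_self_eq_norm_sq] at this
  rw [metricDet, volForm]
  simp only [metricComp, Matrix.of_apply]
  linear_combination -this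

lemma IsOrientedChart.volForm_pos (he : IsOrientedChart o e) (hy : y ∈ e.target) :
    0 < volForm o (e.symm y) (coordVec e 0 y) (coordVec e 1 y) := by
  obtain ⟨b, hb, hbo⟩ := he.2 y hy
  rw [volForm, ← hb, ← hb]
  exact areaForm_pos_of_basis _ b hbo

lemma IsOrientedChart.metricDet_pos (he : IsOrientedChart o e) (hy : y ∈ e.target) :
    0 < metricDet e y := by
  rw [metricDet_eq_volForm_sq o]
  exact pow_pos (he.volForm_pos hy) 2

lemma IsOrientedChart.volForm_eq_sqrt (he : IsOrientedChart o e) (hy : y ∈ e.target) :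
    volForm o (e.symm y) (coordVec e 0 y) (coordVec e 1 y) = √(metricDet e y) := by
  rw [metricDet_eq_volForm_sq o, Real.sqrt_sq (he.volForm_pos hy).le]

lemma IsOrientedChart.sharp_differential (he : IsOrientedChart o e) (hy : y ∈ e.target)
    (hφ : ContMDiff (𝓡 2) 𝓘(ℝ, ℝ) ∞ φ) :
    sharp (e.symm y) (differential φ (e.symm y)) =
      gradComp φ e 0 y • coordVec e 0 y + gradComp φ e 1 y • coordVec e 1 y := by
  have hD := (he.metricDet_pos hy).ne'
  have hd := fun i => formComp_differential he.1 hy hφ.contMDiffAt i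
  simp only [formComp] at hd
  refine ext_inner_right ℝ fun v => ?_
  rw [inner_sharp]
  refine he.ext hy (f := (differential φ (e.symm y)).toLinearMap) (g := innerₛₗ ℝ _) ?_ v
  rw [Fin.forall_fin_two]
  simp only [ContinuousLinearMap.coe_coe, innerₛₗ_apply_apply, inner_add_left,
    real_inner_smul_left, hd]
  rw [metricComp_mul_gradComp_zero hD, metricComp_mul_gradComp_one hD]
  constructor
  · rw [← metricComp_comm]; simp only [metricComp, Matrix.of_apply]; ring
  · simp only [metricComp, Matrix.of_apply]; ring

lemma IsOrientedChart.gradSq_eq (he : IsOrientedChart o e) (hy : y ∈ e.target)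
    (hφ : ContMDiff (𝓡 2) 𝓘(ℝ, ℝ) ∞ φ) :
    gradSq φ (e.symm y) = gradComp φ e 0 y * pderiv 0 (φ ∘ e.symm) y
      + gradComp φ e 1 y * pderiv 1 (φ ∘ e.symm) y := by
  have hd := fun i => formComp_differential he.1 hy hφ.contMDiffAt i
  simp only [formComp] at hd
  rw [gradSq, he.sharp_differential hy hφ]
  simp [hd]

lemma IsOrientedChart.hodgeStar_coordVec_zero (he : IsOrientedChart o e) (hy : y ∈ e.target)
    (hφ : ContMDiff (𝓡 2) 𝓘(ℝ, ℝ) ∞ φ) :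
    hodgeStar o (differential φ) (e.symm y) (coordVec e 0 y) =
      √(metricDet e y) * gradComp φ e 1 y := by
  rw [hodgeStar, he.sharp_differential hy hφ, ← he.volForm_eq_sqrt hy]
  simp [volForm, mul_comm]

lemma IsOrientedChart.hodgeStar_coordVec_one (he : IsOrientedChart o e) (hy : y ∈ e.target)
    (hφ : ContMDiff (𝓡 2) 𝓘(ℝ, ℝ) ∞ φ) :
    hodgeStar o (differential φ) (e.symm y) (coordVec e 1 y) =
      -(√(metricDet e y) * gradComp φ e 0 y) := by
  rw [hodgeStar, he.sharp_differential hy hφ, ← he.volForm_eq_sqrt hy, volForm, map_add, map_smul,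
    map_smul, Orientation.areaForm_apply_self, Orientation.areaForm_swap]
  simp [volForm, mul_comm]

/-- The Hessian equation solved for the second derivatives. -/
lemma IsOrientedChart.pderiv_pderiv {c : S → ℝ} (he : IsOrientedChart o e) (hy : y ∈ e.target)
    (hHess : HessianEq φ c) (i j : Fin 2) :
    pderiv i (pderiv j (φ ∘ e.symm)) y = ∑ l : Fin 2, gradComp φ e l y *
      ((pderiv i (fun z => metricComp e z j l) y + pderiv j (fun z => metricComp e z i l) y
        - pderiv l (fun z => metricComp e z i j) y) / 2)
      + c (e.symm y) * metricComp e y i j := by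
  have := hHess e he.1 y hy i j
  rw [hessComp_eq] at this
  linear_combination this

variable [IsContMDiffRiemannianBundle (𝓡 2) ∞ Plane (fun p : S => TangentSpace (𝓡 2) p)]

lemma IsOrientedChart.contDiffAt_metricDet (he : IsOrientedChart o e) (hy : y ∈ e.target) :
    ContDiffAt ℝ ∞ (metricDet e) y :=
  ((contDiffAt_metricComp he.1 hy 0 0).mul (contDiffAt_metricComp he.1 hy 1 1)).sub
    ((contDiffAt_metricComp he.1 hy 0 1).mul (contDiffAt_metricComp he.1 hy 0 1))

lemma IsOrientedChart.contDiffAt_gradComp (he : IsOrientedChart o e) (hy : y ∈ e.target)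
    (hφ : ContMDiff (𝓡 2) 𝓘(ℝ, ℝ) ∞ φ) (i : Fin 2) : ContDiffAt ℝ ∞ (gradComp φ e i) y := by
  have hD := (he.metricDet_pos hy).ne'
  have hz := fun i => (contDiffAt_comp_symm he.1 hy hφ.contMDiffAt).pderiv i
  have hg := contDiffAt_metricComp he.1 hy
  fin_cases i
  · exact (((hg 1 1).mul (hz 0)).sub ((hg 0 1).mul (hz 1))).div (he.contDiffAt_metricDet hy) hD
  · exact (((hg 0 0).mul (hz 1)).sub ((hg 0 1).mul (hz 0))).div (he.contDiffAt_metricDet hy) hD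

lemma IsOrientedChart.contDiffAt_gradSq (he : IsOrientedChart o e) (hy : y ∈ e.target)
    (hφ : ContMDiff (𝓡 2) 𝓘(ℝ, ℝ) ∞ φ) : ContDiffAt ℝ ∞ (gradSq φ ∘ e.symm) y := by
  have hz := fun i => (contDiffAt_comp_symm he.1 hy hφ.contMDiffAt).pderiv i
  have ha := he.contDiffAt_gradComp hy hφ
  refine (((ha 0).mul (hz 0)).add ((ha 1).mul (hz 1))).congr_of_eventuallyEq ?_
  filter_upwards [e.open_target.mem_nhds hy] with t ht
  exact he.gradSq_eq ht hφ

/-- `∇|∇φ|² = 2 c ∇φ` when `Hess φ = c h`. -/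
lemma IsOrientedChart.pderiv_gradSq {c : S → ℝ} (he : IsOrientedChart o e) (hy : y ∈ e.target)
    (hφ : ContMDiff (𝓡 2) 𝓘(ℝ, ℝ) ∞ φ) (hHess : HessianEq φ c) (k : Fin 2) :
    pderiv k (gradSq φ ∘ e.symm) y = 2 * c (e.symm y) * pderiv k (φ ∘ e.symm) y := by
  have hD : ∀ᶠ t in 𝓝 y, metricDet e t ≠ 0 := by
    filter_upwards [e.open_target.mem_nhds hy] with t ht using (he.metricDet_pos ht).ne'
  have hz := fun i => ((contDiffAt_comp_symm he.1 hy hφ.contMDiffAt).pderiv i).differentiableAt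
    (by simp)
  have hg := fun i j => (contDiffAt_metricComp he.1 hy i j).differentiableAt (by simp)
  have ha := fun i => (he.contDiffAt_gradComp hy hφ i).differentiableAt (by simp)
  have hN : gradSq φ ∘ e.symm =ᶠ[𝓝 y] fun t => gradComp φ e 0 t * pderiv 0 (φ ∘ e.symm) t
      + gradComp φ e 1 t * pderiv 1 (φ ∘ e.symm) t := by
    filter_upwards [e.open_target.mem_nhds hy] with t ht using he.gradSq_eq ht hφ
  have h₀ := metricComp_mul_gradComp_zero (φ := φ) hD.self_of_nhds
  have h₁ := metricComp_mul_gradComp_one (φ := φ) hD.self_of_nhds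
  rw [pderiv_congr hN, pderiv_normSq_grad (c := c (e.symm y)) (hg 0 0) (hg 0 1) (hg 1 1) (hz 0)
    (hz 1) (ha 0) (ha 1) (hD.mono fun t ht => metricComp_mul_gradComp_zero ht)
    (hD.mono fun t ht => metricComp_mul_gradComp_one ht)]
  · fin_cases k <;> rfl
  · rw [he.pderiv_pderiv hy hHess, he.pderiv_pderiv hy hHess]
    fin_cases k <;> simp [Fin.sum_univ_two, metricComp_comm, h₀, h₁] <;> ring

/-- The one-form `-⋆dφ / |dφ|²` is closed when `Hess φ = c h`. -/
lemma IsOrientedChart.hodgeStar_div_gradSq_closed {c : S → ℝ} (he : IsOrientedChart o e)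
    (hy : y ∈ e.target) (hφ : ContMDiff (𝓡 2) 𝓘(ℝ, ℝ) ∞ φ) (hHess : HessianEq φ c)
    (h0 : differential φ (e.symm y) ≠ 0) :
    pderiv 0 (fun t => √(metricDet e t) * gradComp φ e 0 t * (gradSq φ (e.symm t))⁻¹) y =
      pderiv 1 (fun t => -(√(metricDet e t) * gradComp φ e 1 t) * (gradSq φ (e.symm t))⁻¹) y := by
  have hD : ∀ᶠ t in 𝓝 y, 0 < metricDet e t := by
    filter_upwards [e.open_target.mem_nhds hy] with t ht using he.metricDet_pos ht
  have hg := fun i j => (contDiffAt_metricComp he.1 hy i j).differentiableAt (by simp)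
  have ha := fun i => (he.contDiffAt_gradComp hy hφ i).differentiableAt (by simp)
  have hDy := hD.self_of_nhds
  have hr : DifferentiableAt ℝ (fun t => √(metricDet e t)) y :=
    ((he.contDiffAt_metricDet hy).differentiableAt (by simp)).sqrt hDy.ne'
  refine rotated_grad_closed (v := fun t => gradSq φ (e.symm t)) (ha 0) (ha 1) hr
    ((he.contDiffAt_gradSq hy hφ).differentiableAt (by simp)) (gradSq_pos h0).ne'
    (he.gradSq_eq hy hφ) (he.pderiv_gradSq hy hφ hHess 0) (he.pderiv_gradSq hy hφ hHess 1) ?_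
  refine divergence_grad (hg 0 0) (hg 0 1) (hg 1 1) (ha 0) (ha 1) hr (Real.sqrt_pos.2 hDy).ne'
    (hD.mono fun t ht => Real.mul_self_sqrt ht.le)
    (hD.mono fun t ht => metricComp_mul_gradComp_zero ht.ne')
    (hD.mono fun t ht => metricComp_mul_gradComp_one ht.ne') ?_ ?_ ?_ ?_ <;>
  · rw [he.pderiv_pderiv hy hHess]
    simp only [Fin.sum_univ_two, metricComp_comm]
    ring

end Gradient

lemma exists_equiv_of_det_ne_zero (L : Plane →L[ℝ] Plane) {a b c d : ℝ}
    (h0 : ∀ v, L v 0 = v 0 * a + v 1 * b) (h1 : ∀ v, L v 1 = v 0 * c + v 1 * d)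
    (hdet : a * d - b * c ≠ 0) : ∃ M : Plane ≃L[ℝ] Plane, (M : Plane →L[ℝ] Plane) = L := by
  have hinj : Function.Injective (L : Plane →ₗ[ℝ] Plane) := by
    rw [← LinearMap.ker_eq_bot, LinearMap.ker_eq_bot']
    intro v hv
    have e0 := h0 v
    have e1 := h1 v
    rw [ContinuousLinearMap.coe_coe] at hv
    simp only [hv, PiLp.zero_apply] at e0 e1
    ext i
    fin_cases i
    · refine (mul_eq_zero.1 (?_ : (a * d - b * c) * v 0 = 0)).resolve_left hdet
      linear_combination b * e1 - d * e0
    · refine (mul_eq_zero.1 (?_ : (a * d - b * c) * v 1 = 0)).resolve_left hdet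
      linear_combination c * e0 - a * e1
  exact ⟨(LinearEquiv.ofInjectiveEndo _ hinj).toContinuousLinearEquiv, by ext v : 1; rfl⟩

section AdaptedChart

variable {S : Type*} [TopologicalSpace S] [ChartedSpace Plane S] [IsManifold (𝓡 2) ∞ S]
  {e : OpenPartialHomeomorph S Plane}

/-- Two functions with independent differentials on `W` are smooth coordinates near each point. -/
lemma exists_chart_of_jacobian_ne_zero (he : e ∈ IsManifold.maximalAtlas (𝓡 2) ∞ S) {W : Set Plane}
    (hW : IsOpen W) {z x : Plane → ℝ} (hz : ContDiffOn ℝ ∞ z W)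
    (hx : ContDiffOn ℝ ∞ x W)
    (hdet : ∀ y ∈ W, pderiv 0 z y * pderiv 1 x y - pderiv 1 z y * pderiv 0 x y ≠ 0)
    {p : S} (hpe : p ∈ e.source) (hp : e p ∈ W) :
    ∃ e' ∈ IsManifold.maximalAtlas (𝓡 2) ∞ S, p ∈ e'.source ∧ e'.source ⊆ e.source ∩ e ⁻¹' W ∧
      ∀ q ∈ e'.source, e' q 0 = z (e q) ∧ e' q 1 = x (e q) := by
  let Φ : Plane → Plane := fun y => !₂[z y, x y]
  have hΦ : ContDiffOn ℝ ∞ Φ W := by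
    rw [contDiffOn_piLp]
    intro i
    fin_cases i
    exacts [hz, hx]
  have hinv : ∀ y ∈ W, ∃ M : Plane ≃L[ℝ] Plane, HasFDerivAt Φ (M : Plane →L[ℝ] Plane) y := by
    intro y hy
    have hΦy := ((hΦ.contDiffAt (hW.mem_nhds hy)).differentiableAt (by simp)).hasFDerivAt
    have hi : ∀ i v, fderiv ℝ Φ y v i = fderiv ℝ (fun t => Φ t i) y v := fun i v =>
      (DFunLike.congr_fun ((EuclideanSpace.proj (𝕜 := ℝ) i : Plane →L[ℝ] ℝ).hasFDerivAt.comp y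
        hΦy).fderiv v).symm
    obtain ⟨M, hM⟩ := exists_equiv_of_det_ne_zero (fderiv ℝ Φ y)
      (fun v => (hi 0 v).trans (fderiv_apply_eq_pderiv z y v))
      (fun v => (hi 1 v).trans (fderiv_apply_eq_pderiv x y v)) (hdet y hy)
    exact ⟨M, hM ▸ hΦy⟩
  obtain ⟨M, hM⟩ := hinv _ hp
  have hΦp := hΦ.contDiffAt (hW.mem_nhds hp)
  let ψ := (hΦp.toOpenPartialHomeomorph Φ hM (by simp)).restrOpen W hW
  have hψW : ψ.source ⊆ W := fun y hy => hy.2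
  have hψ : ContMDiffOn (𝓡 2) (𝓡 2) ∞ ψ ψ.source :=
    (hΦ.mono hψW).contMDiffOn
  have hψ' : ContMDiffOn (𝓡 2) (𝓡 2) ∞ ψ.symm ψ.target := by
    refine ContDiffOn.contMDiffOn fun t ht => ContDiffAt.contDiffWithinAt ?_
    have ht' := hψW (ψ.map_target ht)
    obtain ⟨M', hM'⟩ := hinv _ ht'
    exact ψ.contDiffAt_symm ht hM' (hΦ.contDiffAt (hW.mem_nhds ht'))
  refine ⟨e.trans ψ, ?_, ?_, ?_, ?_⟩
  · refine OpenPartialHomeomorph.mem_maximalAtlas_of_contMDiffOn _ ?_ ?_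
    · exact hψ.comp ((contMDiffOn_of_mem_maximalAtlas he).mono fun q hq => hq.1) fun q hq => hq.2
    · exact (contMDiffOn_symm_of_mem_maximalAtlas he).comp (hψ'.mono fun q hq => hq.1)
        fun q hq => hq.2
  · exact ⟨hpe, hΦp.mem_toOpenPartialHomeomorph_source hM (by simp), hp⟩
  · exact fun q hq => ⟨hq.1, hψW hq.2⟩
  · exact fun q hq => ⟨rfl, rfl⟩

variable [Bundle.RiemannianBundle (fun p : S => TangentSpace (𝓡 2) p)]
  {o : SurfaceOrientation S}

/-! ### Coordinates adapted to a solution of the Hessian equation -/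

/-- `|dφ|² η = dφ ∧ ξ` for `ξ = -⋆dφ`. -/
lemma gradSq_mul_volForm (o : SurfaceOrientation S) (φ : S → ℝ) (p : S)
    (v w : TangentSpace (𝓡 2) p) :
    gradSq φ p * volForm o p v w = -(differential φ p v * hodgeStar o (differential φ) p w)
      + differential φ p w * hodgeStar o (differential φ) p v := by
  have h := (o.at_point p).inner_mul_areaForm_sub (sharp p (differential φ p)) v w
  rw [inner_sharp, inner_sharp, ← gradSq_eq_norm_sq, Orientation.areaForm_swap _ _ w,
    Orientation.areaForm_swap _ _ v] at h
  rw [volForm, hodgeStar, hodgeStar, volForm, volForm, ← h]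
  ring

/-- `|dφ|² h = dφ² + (⋆dφ)²`. -/
lemma gradSq_mul_inner (o : SurfaceOrientation S) (φ : S → ℝ) (p : S)
    (v w : TangentSpace (𝓡 2) p) :
    gradSq φ p * inner ℝ v w = differential φ p v * differential φ p w
      + hodgeStar o (differential φ) p v * hodgeStar o (differential φ) p w := by
  have h := (o.at_point p).inner_mul_inner_add_areaForm_mul_areaForm
    (sharp p (differential φ p)) v w
  rw [inner_sharp, inner_sharp, ← gradSq_eq_norm_sq, Orientation.areaForm_swap _ _ w,
    Orientation.areaForm_swap _ _ v] at h
  rw [hodgeStar, hodgeStar, volForm, volForm, ← h]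
  ring

variable [IsContMDiffRiemannianBundle (𝓡 2) ∞ Plane (fun p : S => TangentSpace (𝓡 2) p)]

/-- Near every noncritical point of a solution of `Hess φ = c h` there are smooth coordinates
`(φ, x)` with `dx = -⋆dφ / |dφ|²`. -/
lemma IsOrientedChart.exists_adapted_chart {φ c : S → ℝ} (he : IsOrientedChart o e) {p : S}
    (hp : p ∈ e.source) (hφ : ContMDiff (𝓡 2) 𝓘(ℝ, ℝ) ∞ φ) (hHess : HessianEq φ c)
    {U : Set S} (hU : IsOpen U) (hpU : p ∈ U) (hUφ : ∀ q ∈ U, differential φ q ≠ 0) :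
    ∃ e' ∈ IsManifold.maximalAtlas (𝓡 2) ∞ S, ∃ x : S → ℝ, p ∈ e'.source ∧ e'.source ⊆ U ∧
      (∀ q ∈ e'.source, e' q 0 = φ q ∧ e' q 1 = x q) ∧
      ∀ q ∈ e'.source, ContMDiffAt (𝓡 2) 𝓘(ℝ, ℝ) ∞ x q ∧ ∀ a : TangentSpace (𝓡 2) q,
        hodgeStar o (differential φ) q a = -gradSq φ q * differential x q a := by
  obtain ⟨ε, hε, hB⟩ := Metric.isOpen_iff.1 (e.isOpen_inter_preimage_symm hU) (e p)
    ⟨e.map_source hp, by simpa [e.left_inv hp] using hpU⟩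
  set B := Metric.ball (e p) ε with hB_def
  have hBo : IsOpen B := Metric.isOpen_ball
  have hBt : ∀ y ∈ B, y ∈ e.target := fun y hy => (hB hy).1
  have h0 : ∀ y ∈ B, differential φ (e.symm y) ≠ 0 := fun y hy => hUφ _ (hB hy).2
  have hN : ∀ y ∈ B, gradSq φ (e.symm y) ≠ 0 := fun y hy => (gradSq_pos (h0 y hy)).ne'
  have hr : ∀ y ∈ B, ContDiffAt ℝ ∞ (fun t => √(metricDet e t)) y := fun y hy =>
    (he.contDiffAt_metricDet (hBt y hy)).sqrt (he.metricDet_pos (hBt y hy)).ne'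
  have hi : ∀ y ∈ B, ContDiffAt ℝ ∞ (fun t => (gradSq φ (e.symm t))⁻¹) y := fun y hy =>
    (he.contDiffAt_gradSq (hBt y hy) hφ).inv (hN y hy)
  have ha := fun i y hy => he.contDiffAt_gradComp (hBt y hy) hφ i
  obtain ⟨x, hx, hdx⟩ := exists_smooth_primitive (y₀ := e p) (ε := ε)
    (fun y hy => (((hr y hy).mul (ha 1 y hy)).neg.mul (hi y hy)).contDiffWithinAt)
    (fun y hy => (((hr y hy).mul (ha 0 y hy)).mul (hi y hy)).contDiffWithinAt)
    fun y hy => he.hodgeStar_div_gradSq_closed (hBt y hy) hφ hHess (h0 y hy)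
  have hz : ContDiffOn ℝ ∞ (φ ∘ e.symm) B := fun y hy =>
    (contDiffAt_comp_symm he.1 (hBt y hy) hφ.contMDiffAt).contDiffWithinAt
  obtain ⟨e', he', hpe', hsub, hcoord⟩ := exists_chart_of_jacobian_ne_zero he.1 hBo hz hx
    (fun y hy => by
      -- the Jacobian of `(φ, x)` is the area density
      have hD := Real.sqrt_pos.2 (he.metricDet_pos (hBt y hy))
      rw [(hdx y hy).1, (hdx y hy).2]
      convert hD.ne' using 1
      have := hN y hy
      field_simp
      rw [he.gradSq_eq (hBt y hy) hφ]
      ring) hp (Metric.mem_ball_self hε)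
  refine ⟨e', he', x ∘ e, hpe', fun q hq => ?_, fun q hq => ?_, fun q hq => ?_⟩
  · have := (hB (hsub hq).2).2
    rwa [mem_preimage, e.left_inv (hsub hq).1] at this
  · refine ⟨?_, (hcoord q hq).2⟩
    rw [(hcoord q hq).1, Function.comp, e.left_inv (hsub hq).1]
  · have hqe := (hsub hq).1
    have hy : e q ∈ B := (hsub hq).2
    obtain ⟨y, hyq⟩ : ∃ y, y = e q := ⟨_, rfl⟩
    have hqy : q = e.symm y := by rw [hyq, e.left_inv hqe]
    rw [← hyq] at hy
    have hxq : ContMDiffAt (𝓡 2) 𝓘(ℝ, ℝ) ∞ (x ∘ e) q :=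
      ContMDiffAt.comp q (hyq ▸ (hx.contDiffAt (hBo.mem_nhds hy))).contMDiffAt
        (contMDiffAt_of_mem_maximalAtlas he.1 hqe)
    refine ⟨hxq, ?_⟩
    subst hqy
    have hcomp : ∀ i, differential (x ∘ e) (e.symm y) (coordVec e i y) = pderiv i x y := by
      intro i
      refine (formComp_differential he.1 (hBt y hy) hxq i).trans (pderiv_congr ?_)
      filter_upwards [e.open_target.mem_nhds (hBt y hy)] with t ht
      simp [e.right_inv ht]
    have key : ∀ i, ((o.at_point (e.symm y)).areaForm.flip
          (sharp (e.symm y) (differential φ (e.symm y)))) (coordVec e i y) =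
        (-gradSq φ (e.symm y) • (differential (x ∘ e) (e.symm y)).toLinearMap)
          (coordVec e i y) := by
      have := hN y hy
      rw [Fin.forall_fin_two]
      constructor
      · refine (he.hodgeStar_coordVec_zero (hBt y hy) hφ).trans ?_
        simp only [LinearMap.smul_apply, ContinuousLinearMap.coe_coe, hcomp, (hdx y hy).1,
          smul_eq_mul]
        field_simp
      · refine (he.hodgeStar_coordVec_one (hBt y hy) hφ).trans ?_
        simp only [LinearMap.smul_apply, ContinuousLinearMap.coe_coe, hcomp, (hdx y hy).2,
          smul_eq_mul]
        field_simp
    exact he.ext (hBt y hy) key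

end AdaptedChart

/-! ### Integration over a connected set without critical points -/

/-- A smooth function on an open interval has a smooth primitive. -/
lemma exists_primitive {J : Set ℝ} (hJ : IsOpen J) (hJc : Convex ℝ J) {g : ℝ → ℝ}
    (hg : ContDiffOn ℝ ∞ g J) :
    ∃ G : ℝ → ℝ, ContDiffOn ℝ ∞ G J ∧ ∀ ζ ∈ J, HasDerivAt G (g ζ) ζ := by
  obtain ⟨G, hG⟩ := hJc.exists_forall_hasDerivWithinAt (hg.differentiableOn (by simp))
  have hG' : ∀ ζ ∈ J, HasDerivAt G (g ζ) ζ := fun ζ hζ => (hG ζ hζ).hasDerivAt (hJ.mem_nhds hζ)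
  refine ⟨G, (contDiffOn_infty_iff_deriv_of_isOpen hJ).2
    ⟨fun ζ hζ => (hG' ζ hζ).differentiableAt.differentiableWithinAt,
      hg.congr fun ζ hζ => (hG' ζ hζ).deriv⟩, hG'⟩

section Integration

variable {S : Type*} [TopologicalSpace S] [ChartedSpace Plane S] [IsManifold (𝓡 2) ∞ S]
  {φ : S → ℝ} {U : Set S}

lemma IsOrientedChart.differential_eq_zero {o : SurfaceOrientation S}
    {e : OpenPartialHomeomorph S Plane} {y : Plane} (he : IsOrientedChart o e) (hy : y ∈ e.target)
    (hφ : ContMDiff (𝓡 2) 𝓘(ℝ, ℝ) ∞ φ) (h : ∀ i, pderiv i (φ ∘ e.symm) y = 0) :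
    differential φ (e.symm y) = 0 := by
  ext v
  refine he.ext hy (f := (differential φ (e.symm y)).toLinearMap) (g := 0) (fun i => ?_) v
  exact (formComp_differential he.1 hy hφ.contMDiffAt i).trans (h i)

lemma isOpen_differential_ne_zero (hφ : ContMDiff (𝓡 2) 𝓘(ℝ, ℝ) ∞ φ)
    (o : SurfaceOrientation S) : IsOpen {q | differential φ q ≠ 0} := by
  rw [isOpen_iff_mem_nhds]
  intro q hq
  obtain ⟨e, he, hqe, heo⟩ := o.continuous' q
  have hy := e.map_source hqe
  obtain ⟨i, hi⟩ : ∃ i, pderiv i (φ ∘ e.symm) (e q) ≠ 0 := by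
    by_contra! h
    have := IsOrientedChart.differential_eq_zero (o := o) ⟨he, heo⟩ hy hφ h
    rw [e.left_inv hqe] at this
    exact hq this
  have hcont := ((contDiffAt_comp_symm he hy hφ.contMDiffAt).pderiv i).continuousAt.comp
    (e.continuousAt hqe)
  filter_upwards [e.open_source.mem_nhds hqe, hcont.eventually_ne hi] with q' hq' hne h0
  refine hne ?_
  rw [Function.comp, ← formComp_differential he (e.map_source hq') hφ.contMDiffAt, formComp,
    e.left_inv hq', h0]
  rfl

/-- A function without critical points is an open map. -/
lemma isOpen_image_of_differential_ne_zero (hφ : ContMDiff (𝓡 2) 𝓘(ℝ, ℝ) ∞ φ)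
    (o : SurfaceOrientation S) (hU : IsOpen U) (hUφ : ∀ q ∈ U, differential φ q ≠ 0) :
    IsOpen (φ '' U) := by
  rw [isOpen_iff_mem_nhds]
  rintro _ ⟨q, hq, rfl⟩
  obtain ⟨e, he, hqe, heo⟩ := o.continuous' q
  have hy := e.map_source hqe
  have hqy : e.symm (e q) = q := e.left_inv hqe
  have hz := contDiffAt_comp_symm he hy hφ.contMDiffAt
  have hsurj : (fderiv ℝ (φ ∘ e.symm) (e q)).range = ⊤ := by
    refine LinearMap.range_eq_top.2 (LinearMap.surjective_of_ne_zero fun h0 => ?_)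
    refine hUφ q hq ?_
    have hzero := IsOrientedChart.differential_eq_zero (o := o) ⟨he, heo⟩ hy hφ
      fun i => DFunLike.congr_fun h0 _
    rwa [hqy] at hzero
  have hmap := (hz.hasStrictFDerivAt (by simp)).map_nhds_eq_of_surj hsurj
  rw [Function.comp, hqy] at hmap
  rw [← hmap, mem_map]
  filter_upwards [(e.isOpen_inter_preimage_symm hU).mem_nhds ⟨hy, by simpa [hqy] using hq⟩]
    with t ht using ⟨_, ht.2, rfl⟩

variable [Bundle.RiemannianBundle (fun p : S => TangentSpace (𝓡 2) p)]
  {o : SurfaceOrientation S}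

/-- If `dx = -⋆dφ / |dφ|²` and `dα = f(φ) η`, then `α - F(φ) dx` is closed whenever `F' = f`. -/
lemma closedFormOn_sub_smul {f F : ℝ → ℝ} {x : S → ℝ} {α : OneForm S} {s : Set S} (hs : IsOpen s)
    (hφ : ContMDiff (𝓡 2) 𝓘(ℝ, ℝ) ∞ φ) (hα : SmoothFormOn α univ)
    (hdα : ExtDerivEq o α (f ∘ φ)) (hF : ∀ q ∈ s, HasDerivAt F (f (φ q)) (φ q))
    (h0 : ∀ q ∈ s, differential φ q ≠ 0) (hx : ∀ q ∈ s, ContMDiffAt (𝓡 2) 𝓘(ℝ, ℝ) ∞ x q)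
    (hdx : ∀ q ∈ s, ∀ a : TangentSpace (𝓡 2) q,
      hodgeStar o (differential φ) q a = -gradSq φ q * differential x q a) :
    ClosedFormOn (fun q => α q - F (φ q) • differential x q) s := by
  intro e he y hy hys i j
  have hcomp : ∀ k, formComp (fun q => α q - F (φ q) • differential x q) e k =ᶠ[𝓝 y]
      fun t => formComp α e k t - F ((φ ∘ e.symm) t) * pderiv k (x ∘ e.symm) t := by
    intro k
    filter_upwards [(e.isOpen_inter_preimage_symm hs).mem_nhds ⟨hy, hys⟩] with t ht
    rw [← formComp_differential he ht.1 (hx _ ht.2) k]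
    rfl
  have hzd := (contDiffAt_comp_symm he hy hφ.contMDiffAt).differentiableAt (by simp)
  have hxs := contDiffAt_comp_symm he hy (hx _ hys)
  have hxd := fun k => (hxs.pderiv k).differentiableAt (by simp)
  have hαd := fun k => (contDiffAt_formComp he hy hα isOpen_univ (mem_univ _) k).differentiableAt
    (by simp)
  have hFz : HasDerivAt F (f (φ (e.symm y))) ((φ ∘ e.symm) y) := hF _ hys
  have hFd : DifferentiableAt ℝ (fun t => F ((φ ∘ e.symm) t)) y :=
    hFz.differentiableAt.comp y hzd
  have hvol : volForm o (e.symm y) (coordVec e i y) (coordVec e j y) =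
      pderiv i (φ ∘ e.symm) y * pderiv j (x ∘ e.symm) y
        - pderiv j (φ ∘ e.symm) y * pderiv i (x ∘ e.symm) y := by
    refine mul_left_cancel₀ (gradSq_pos (h0 _ hys)).ne' ?_
    have hz' := fun k => formComp_differential he hy hφ.contMDiffAt (φ := φ) k
    have hx' := fun k => formComp_differential he hy (hx _ hys) k
    simp only [formComp] at hz' hx'
    rw [gradSq_mul_volForm, hdx _ hys, hdx _ hys, hz', hz', hx', hx']
    ring
  have hd := hdα e he y hy i j
  rw [extDerivComp, hvol] at hd
  rw [extDerivComp, pderiv_congr (hcomp j), pderiv_congr (hcomp i),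
    pderiv_sub (hαd j) (hFd.fun_mul (hxd j)), pderiv_sub (hαd i) (hFd.fun_mul (hxd i)),
    pderiv_mul hFd (hxd j), pderiv_mul hFd (hxd i), pderiv_comp hFz hzd, pderiv_comp hFz hzd,
    pderiv_pderiv_comm hxs i j]
  simp only [Function.comp] at hd ⊢
  linear_combination hd

variable [IsContMDiffRiemannianBundle (𝓡 2) ∞ Plane (fun p : S => TangentSpace (𝓡 2) p)]

/-- On a connected set `|dφ|² - 2 ∫ u(φ) dφ` is constant when `Hess φ = u(φ) h`. -/
lemma exists_gradSq_eq_add {u G : ℝ → ℝ} (o : SurfaceOrientation S)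
    (hφ : ContMDiff (𝓡 2) 𝓘(ℝ, ℝ) ∞ φ) (hHess : HessianEq φ (u ∘ φ)) (hU : IsOpen U)
    (hUc : IsPreconnected U) (hG : ∀ q ∈ U, HasDerivAt G (2 * u (φ q)) (φ q)) :
    ∃ c : ℝ, ∀ q ∈ U, gradSq φ q = G (φ q) + c := by
  let ψ : S → ℝ := fun q => gradSq φ q - G (φ q)
  have hloc : ∀ q ∈ U, ∀ᶠ q' in 𝓝 q, ψ q' = ψ q := by
    intro q hq
    obtain ⟨e, he, hqe, heo⟩ := o.continuous' q
    have heo : IsOrientedChart o e := ⟨he, heo⟩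
    obtain ⟨ε, hε, hB⟩ := Metric.isOpen_iff.1 (e.isOpen_inter_preimage_symm hU) (e q)
      ⟨e.map_source hqe, by simpa [e.left_inv hqe] using hq⟩
    have hd : ∀ y ∈ Metric.ball (e q) ε, DifferentiableAt ℝ (ψ ∘ e.symm) y ∧
        fderiv ℝ (ψ ∘ e.symm) y = 0 := by
      intro y hy
      have hyt := (hB hy).1
      have hzd := (contDiffAt_comp_symm he hyt hφ.contMDiffAt).differentiableAt (by simp)
      have hN := (heo.contDiffAt_gradSq hyt hφ).differentiableAt (by simp)
      have hGy : HasDerivAt G (2 * u (φ (e.symm y))) ((φ ∘ e.symm) y) := hG _ (hB hy).2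
      have hGd : DifferentiableAt ℝ (fun t => G ((φ ∘ e.symm) t)) y :=
        hGy.differentiableAt.comp y hzd
      refine ⟨hN.sub hGd, fderiv_eq_zero_of_pderiv fun i => ?_⟩
      refine (pderiv_sub hN hGd).trans ?_
      rw [heo.pderiv_gradSq hyt hφ hHess, pderiv_comp hGy hzd, Function.comp, sub_self]
    filter_upwards [(e.isOpen_inter_preimage Metric.isOpen_ball).mem_nhds
      ⟨hqe, Metric.mem_ball_self hε⟩] with q' hq'
    have := Metric.isOpen_ball.is_const_of_fderiv_eq_zero
      (convex_ball (e q) ε).isPreconnected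
      (fun y hy => (hd y hy).1.differentiableWithinAt) (fun y hy => (hd y hy).2)
      hq'.2 (Metric.mem_ball_self hε)
    simpa [e.left_inv hq'.1, e.left_inv hqe] using this
  rcases U.eq_empty_or_nonempty with rfl | ⟨q₀, hq₀⟩
  · exact ⟨0, by simp⟩
  have hlc : IsLocallyConstant (fun q : U => ψ q) := by
    rw [IsLocallyConstant.iff_eventually_eq]
    exact fun q => continuousAt_subtype_val.eventually (hloc q q.2)
  have : PreconnectedSpace U := isPreconnected_iff_preconnectedSpace.1 hUc
  refine ⟨ψ q₀, fun q hq => ?_⟩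
  have := hlc.apply_eq_of_preconnectedSpace ⟨q, hq⟩ ⟨q₀, hq₀⟩
  simp only [ψ] at this ⊢
  linarith

end Integration

end Surface

end

theorem lemma10 {S : Type*} [TopologicalSpace S] [ChartedSpace Surface.Plane S]
    [IsManifold (𝓡 2) ∞ S]
    [Bundle.RiemannianBundle (fun p : S => TangentSpace (𝓡 2) p)]
    [IsContMDiffRiemannianBundle (𝓡 2) ∞ Surface.Plane (fun p : S => TangentSpace (𝓡 2) p)]
    (o : Surface.SurfaceOrientation S)
    (I : Set ℝ) (u f : ℝ → ℝ) (hu : ContDiffOn ℝ ∞ u I) (hf : ContDiffOn ℝ ∞ f I)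
    (Z : S → ℝ) (hZ : ContMDiff (𝓡 2) 𝓘(ℝ, ℝ) ∞ Z) (hZI : ∀ p, Z p ∈ I)
    (w : Surface.OneForm S) (hw : Surface.SmoothFormOn w Set.univ)
    (hHess : Surface.HessianEq Z (u ∘ Z))
    (hdw : Surface.ExtDerivEq o w (f ∘ Z))
    (p₀ : S) (hp₀ : Surface.differential Z p₀ ≠ 0)
    (U : Set S) (hU : U = connectedComponentIn {p : S | Surface.differential Z p ≠ 0} p₀) :
    ∃ V F : ℝ → ℝ,
      (∀ ζ ∈ Z '' U, HasDerivAt V (2 * u ζ) ζ) ∧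
      (∀ ζ ∈ Z '' U, HasDerivAt F (f ζ) ζ) ∧
      ∀ p ∈ U, ∃ e ∈ IsManifold.maximalAtlas (𝓡 2) ∞ S, ∃ x : S → ℝ,
        p ∈ e.source ∧ e.source ⊆ U ∧
        -- the coordinates of the chart `e` are `(Z, x)`
        (∀ q ∈ e.source, e q 0 = Z q ∧ e q 1 = x q) ∧
        -- `h = dZ² / V(Z) + V(Z) dx²`
        (∀ q ∈ e.source, ∀ a b : TangentSpace (𝓡 2) q,
          inner ℝ a b =
            Surface.differential Z q a * Surface.differential Z q b / V (Z q) +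
              V (Z q) * (Surface.differential x q a * Surface.differential x q b)) ∧
        -- `w = F(Z) dx + w₀` with `w₀` closed
        (∃ w₀ : Surface.OneForm S, Surface.SmoothFormOn w₀ e.source ∧
          Surface.ClosedFormOn w₀ e.source ∧
          ∀ q ∈ e.source, w q = F (Z q) • Surface.differential x q + w₀ q) ∧
        -- `⋆dZ = -V(Z) dx`
        (∀ q ∈ e.source, ∀ a : TangentSpace (𝓡 2) q,
          Surface.hodgeStar o (Surface.differential Z) q a =
            -(V (Z q)) * Surface.differential x q a) := by
  have hlc : LocallyConnectedSpace S := ChartedSpace.locallyConnectedSpace Surface.Plane S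
  have hUsub : ∀ q ∈ U, Surface.differential Z q ≠ 0 := fun q hq =>
    connectedComponentIn_subset _ _ (hU ▸ hq)
  have hUc : IsPreconnected U := hU ▸ isPreconnected_connectedComponentIn
  have hUo : IsOpen U := by
    rw [hU]
    exact (Surface.isOpen_differential_ne_zero hZ o).connectedComponentIn
  have hJo : IsOpen (Z '' U) := Surface.isOpen_image_of_differential_ne_zero hZ o hUo hUsub
  have hJc : Convex ℝ (Z '' U) :=
    (hUc.image Z hZ.continuous.continuousOn).ordConnected.convex
  have hJI : Z '' U ⊆ I := by rintro _ ⟨q, -, rfl⟩; exact hZI q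
  obtain ⟨G, -, hG⟩ := Surface.exists_primitive hJo hJc
    ((contDiffOn_const (c := (2 : ℝ))).mul (hu.mono hJI))
  obtain ⟨F, hFs, hF⟩ := Surface.exists_primitive hJo hJc (hf.mono hJI)
  obtain ⟨c, hc⟩ := Surface.exists_gradSq_eq_add o hZ hHess hUo hUc
    fun q hq => hG _ (Set.mem_image_of_mem Z hq)
  refine ⟨fun ζ => G ζ + c, F, fun ζ hζ => (hG ζ hζ).add_const c, hF, fun p hp => ?_⟩
  obtain ⟨e₀, he₀, hpe₀, heo₀⟩ := o.continuous' p
  obtain ⟨e, he, x, hpe, heU, hcoord, hx⟩ :=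
    Surface.IsOrientedChart.exists_adapted_chart ⟨he₀, heo₀⟩ hpe₀ hZ hHess hUo hp hUsub
  refine ⟨e, he, x, hpe, heU, hcoord, fun q hq a b => ?_,
    ⟨fun q => w q - F (Z q) • Surface.differential x q, ?_, ?_,
      fun q hq => (add_sub_cancel _ _).symm⟩,
    fun q hq a => ?_⟩
  · change _ = _ / (G (Z q) + c) + (G (Z q) + c) * _
    have hV := Surface.gradSq_pos (hUsub q (heU hq))
    have h := Surface.gradSq_mul_inner o Z q a b
    rw [(hx q hq).2, (hx q hq).2] at h
    rw [← hc q (heU hq)]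
    field_simp
    linear_combination h
  · have hFZ : ContMDiffOn (𝓡 2) 𝓘(ℝ, ℝ) ∞ (fun q => F (Z q)) e.source :=
      hFs.contMDiffOn.comp hZ.contMDiffOn fun q hq => Set.mem_image_of_mem Z (heU hq)
    exact (hw.mono (Set.subset_univ _)).sub_section (hFZ.smul_section
      (Surface.smoothFormOn_differential fun q hq => (hx q hq).1))
  · exact Surface.closedFormOn_sub_smul e.open_source hZ hw hdw
      (fun q hq => hF _ (Set.mem_image_of_mem Z (heU hq))) (fun q hq => hUsub q (heU hq))
      (fun q hq => (hx q hq).1) fun q hq => (hx q hq).2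
  · change _ = -(G (Z q) + c) * _
    rw [← hc q (heU hq)]
    exact (hx q hq).2 a
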